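/- Let $(H(k))_{k\in\mathbb Z}$ and $(V(k))_{k\in\mathbb Z}$ be two independent families of i.i.d. positive random variables on a probability space $(\Omega,\mathcal F,\mathbb P)$. For $x=(x_1,x_2)\in\mathbb Z^2$ put $$\omega(x,x\pm e_1)=H(x_2),\qquad \omega(x,x\pm e_2)=V(x_1),$$ with $e_1=(1,0)$, $e_2=(0,1)$, and $\omega(x,y)=0$ if $|x-y|\ne 1$. Assume: (H1) there is a constant $c>0$ such that, almost surely, $H(k)\ge c$ and $V(k)\ge c$ for all $k\in\mathbb Z$; (H2) there are exponents $\alpha_1,\alpha_2>0$ and constants $c_H,c_V>0$ such that, as $L\to\infty$, $$\mathbb P(H(0)>L)=c_H\,L^{-\alpha_1(1+o(1))},\qquad \mathbb P(V(0)>L)=c_V\,L^{-\alpha_2(1+o(1))}.$$ For a given environment $\omega$, let $X=(X(t))_{t\ge 0}$ be the (minimal) continuous-time random walk on $\mathbb Z^2$ started from $0$ with generator $$\mathcal L^\omega f(x)=\sum_{|e|=1}\omega(x,x+e)\,\bigl(f(x+e)-f(x)\bigr);$$ that is, at $x$ it waits an exponential time of rate $\sum_{|e|=1}\omega(x,x+e)$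 and then, independently of that time, jumps to $x+e$ with probability proportional to $\omega(x,x+e)$. Let $P^\omega_0$ be its law. Set $$\varepsilon_i=\max\Bigl\{\tfrac12\Bigl(\tfrac1{\alpha_i}-1\Bigr),\,0\Bigr\},\qquad i=1,2.$$ If $\varepsilon_1\varepsilon_2<1$, then for $\mathbb P$-almost every environment $\omega$ the walk $X$ is conservative: for every $t<\infty$, $$P^\omega_0\bigl(\text{the number of jumps of }X\text{ in }[0,t]\text{ is finite}\bigr)=1.$$ -/

import Mathlib

open MeasureTheory ProbabilityTheory Filter Topology
open scoped NNReal ENNReal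

namespace LineModel

noncomputable section

/-- The four unit vectors `±e₁`, `±e₂` of `ℤ²`. -/
def unitSteps : Finset (ℤ × ℤ) := {(1, 0), (-1, 0), (0, 1), (0, -1)}

/-- The line-model conductances: `ω(x, x ± e₁) = H(x₂)`, `ω(x, x ± e₂) = V(x₁)`, and
`ω(x, y) = 0` if `|x - y| ≠ 1`. -/
def conductance (H V : ℤ → ℝ≥0) (x y : ℤ × ℤ) : ℝ≥0 :=
  if y - x = (1, 0) ∨ y - x = (-1, 0) then H x.2
  else if y - x = (0, 1) ∨ y - x = (0, -1) then V x.1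
  else 0

/-! ### The variable-speed random walk among nearest-neighbour conductances

Given conductances `c`, the walk with generator
`(L f)(x) = ∑_{|e| = 1} c(x, x + e) (f (x + e) - f x)`
is the minimal continuous-time jump chain with these rates: at `x` it waits an exponential time of
rate `∑_{|e| = 1} c(x, x + e)` and then, independently of that time, moves to `x + e` with
probability proportional to `c(x, x + e)`. Its law is built on the space of
sequences (waiting time, new position). -/

/-- The total jump rate at `x`. -/
def totalRate (c : ℤ × ℤ → ℤ × ℤ → ℝ≥0) (x : ℤ × ℤ) : ℝ≥0 :=
  ∑ e ∈ unitSteps, c x (x + e)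

/-- The exponential law of rate `r` on `[0, ∞]`; for rate `0` the waiting time is `∞`. -/
def waitLaw (r : ℝ≥0) : Measure ℝ≥0∞ :=
  if r = 0 then Measure.dirac ∞ else (expMeasure (r : ℝ)).map ENNReal.ofReal

/-- The law of the position after the next jump from `x`: the neighbour `x + e` has probability
`c(x, x + e) / totalRate c x`. (A state of total rate `0` is absorbing.) -/
def jumpLaw (c : ℤ × ℤ → ℤ × ℤ → ℝ≥0) (x : ℤ × ℤ) : Measure (ℤ × ℤ) :=
  if totalRate c x = 0 then Measure.dirac x
  else ∑ e ∈ unitSteps, ((c x (x + e) / totalRate c x : ℝ≥0) : ℝ≥0∞) • Measure.dirac (x + e)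

instance isProbabilityMeasure_waitLaw (r : ℝ≥0) : IsProbabilityMeasure (waitLaw r) := by
  unfold waitLaw
  split_ifs with h
  · infer_instance
  · have : IsProbabilityMeasure (expMeasure (r : ℝ)) :=
      isProbabilityMeasure_expMeasure (by exact_mod_cast pos_iff_ne_zero.mpr h)
    exact Measure.isProbabilityMeasure_map ENNReal.measurable_ofReal.aemeasurable

instance isProbabilityMeasure_jumpLaw (c : ℤ × ℤ → ℤ × ℤ → ℝ≥0) (x : ℤ × ℤ) :
    IsProbabilityMeasure (jumpLaw c x) := by
  unfold jumpLaw
  split_ifs with h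
  · infer_instance
  · constructor
    simp only [Measure.coe_finsetSum, Finset.sum_apply, Measure.smul_apply, measure_univ,
      smul_eq_mul, mul_one]
    rw [← ENNReal.ofNNReal_finsetSum, ← Finset.sum_div]
    change ((totalRate c x / totalRate c x : ℝ≥0) : ℝ≥0∞) = 1
    rw [div_self h, ENNReal.coe_one]

/-- One step of the walk from the position `x`: the pair (time spent at `x`, next position), whose
two components are independent. -/
def stepKernel (c : ℤ × ℤ → ℤ × ℤ → ℝ≥0) : Kernel (ℤ × ℤ) (ℝ≥0∞ × (ℤ × ℤ)) :=
  Kernel.ofFunOfCountable fun x => (waitLaw (totalRate c x)).prod (jumpLaw c x)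

instance isMarkovKernel_stepKernel (c : ℤ × ℤ → ℤ × ℤ → ℝ≥0) :
    IsMarkovKernel (stepKernel c) :=
  ⟨fun x => inferInstanceAs
    (IsProbabilityMeasure ((waitLaw (totalRate c x)).prod (jumpLaw c x)))⟩

/-- A trajectory `γ`: `(γ n).2` is the position after `n` jumps, and `(γ (n + 1)).1` is the time
spent between the `n`-th jump and the `(n + 1)`-st one. -/
abbrev Trajectory : Type := ℕ → ℝ≥0∞ × (ℤ × ℤ)

/-- The step kernel as a function of the history up to the `n`-th jump; it depends only on the
current position. -/
def historyKernel (c : ℤ × ℤ → ℤ × ℤ → ℝ≥0) (n : ℕ) :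
    Kernel (Π _ : Finset.Iic n, ℝ≥0∞ × (ℤ × ℤ)) (ℝ≥0∞ × (ℤ × ℤ)) :=
  (stepKernel c).comap (fun p => (p ⟨n, Finset.mem_Iic.mpr le_rfl⟩).2)
    (measurable_snd.comp (measurable_pi_apply _))

instance isMarkovKernel_historyKernel (c : ℤ × ℤ → ℤ × ℤ → ℝ≥0) (n : ℕ) :
    IsMarkovKernel (historyKernel c n) := by
  unfold historyKernel
  infer_instance

/-- The law of the walk with conductances `c` started from `0` at time `0`. -/
def walkLaw (c : ℤ × ℤ → ℤ × ℤ → ℝ≥0) : Measure Trajectory :=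
  Kernel.traj (X := fun _ => ℝ≥0∞ × (ℤ × ℤ)) (historyKernel c) 0 (fun _ => (0, (0, 0)))

/-- The time of the `n`-th jump (`0` for `n = 0`). -/
def jumpTime (γ : Trajectory) (n : ℕ) : ℝ≥0∞ :=
  ∑ k ∈ Finset.range n, (γ (k + 1)).1

/-- The number of jumps in the time interval `[0, t]`, infinite in case of an explosion. -/
def numJumps (γ : Trajectory) (t : ℝ≥0) : ℕ∞ :=
  Set.encard {n : ℕ | 1 ≤ n ∧ jumpTime γ n ≤ t}

end

end LineModel

/-!
Let `u x = E_x[exp (-T)]`, where `T` is the explosion time of the walk started from `x`. As the limit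
of `E_x[exp (-J n)]` over the jump times `J n`, it satisfies `0 ≤ u ≤ 1` and `ℒ u = u`, that is
`u = H(x₂) Δ₁ u + V(x₁) Δ₂ u` (`explosionLaplace_eq`), and `u 0 = 0` says that the walk from `0` does
not explode (`ae_numJumps_lt_top`).

Sum this identity over `x` in a box of sides `m` and `n` against a product of two tents. Along each
row `H` is constant, so that summation by parts moves the second difference onto the tent, which is
concave except at its boundary; since `0 ≤ u ≤ 1`, each row contributes at most a boundary term, and
likewise each column. Hence the average of `u` over the box is at most
`2 (∑ H) / (m² n) + 2 (∑ V) / (n² m)`, with linear sums of the conductances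
(`sum_explosionLaplace_le`, `boxAverage_le`).

The environment is stationary under translations of `ℤ²`, so the mean of that average over the
environment is the mean of `u 0` (`lintegral_boxAverage`). The tails give finite moments of all
orders `p < min α₁ 1` and `q < min α₂ 1`, and by subadditivity of `t ↦ t ^ p` the sums of about `n`
terms `H` and of about `m` terms `V` are at most of order `n ^ (1 / p)` and `m ^ (1 / q)`. Thus both
terms vanish in the limit if `m` is much larger than `n ^ e₁` and `n` much larger than `m ^ e₂`, with
`e₁ = (1 / p - 1) / 2` and `e₂ = (1 / q - 1) / 2`. A choice `m = n ^ a` does this as soon as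
`e₁ e₂ < 1`, which `ε₁ ε₂ < 1` permits (`exists_exponents`). So `u 0` has mean `0` and vanishes almost
surely.
-/

open MeasureTheory ProbabilityTheory Filter Topology
open scoped NNReal ENNReal

namespace LineModel

/-! ### Jump times of the walk and their Laplace transforms -/

/-- The factor `exp (-t)` for a time `t ∈ [0, ∞]`, with `exp (-∞) = 0`. -/
noncomputable def discount (t : ℝ≥0∞) : ℝ≥0∞ := EReal.exp (-(t : EReal))

lemma measurable_discount : Measurable discount := by
  unfold discount
  exact EReal.measurable_exp.comp (measurable_coe_ennreal_ereal.neg)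

lemma discount_zero : discount 0 = 1 := by simp [discount]

lemma discount_top : discount ∞ = 0 := by simp [discount]

lemma discount_ofReal {t : ℝ} (ht : 0 ≤ t) :
    discount (ENNReal.ofReal t) = ENNReal.ofReal (Real.exp (-t)) := by
  rw [discount, EReal.coe_ennreal_ofReal, max_eq_left ht, ← EReal.coe_neg, EReal.exp_coe]

lemma discount_add (s t : ℝ≥0∞) : discount (s + t) = discount s * discount t := by
  unfold discount
  rw [EReal.coe_ennreal_add, ← EReal.exp_add, EReal.neg_add, sub_eq_add_neg]
  · left; exact EReal.coe_ennreal_ne_bot s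
  · right; exact EReal.coe_ennreal_ne_bot t

lemma discount_le_iff {s t : ℝ≥0∞} : discount s ≤ discount t ↔ t ≤ s := by
  simp [discount]

lemma discount_pos {t : ℝ≥0∞} (ht : t ≠ ∞) : 0 < discount t := by
  rw [discount, EReal.zero_lt_exp_iff, bot_lt_iff_ne_bot]
  simpa [EReal.neg_eq_bot_iff] using ht

/-- The Laplace transform at `1` of the exponential law of rate `r`. -/
lemma lintegral_discount_waitLaw (r : ℝ≥0) :
    ∫⁻ t, discount t ∂(waitLaw r) = ((r / (1 + r) : ℝ≥0) : ℝ≥0∞) := by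
  unfold waitLaw
  split_ifs with h
  · subst h
    simp [lintegral_dirac' _ measurable_discount, discount_top]
  have hr : 0 < (r : ℝ) := by exact_mod_cast pos_iff_ne_zero.mpr h
  rw [lintegral_map measurable_discount ENNReal.measurable_ofReal]
  have hpdf : expMeasure (r : ℝ) = volume.withDensity (exponentialPDF r) := rfl
  have hm (s : ℝ) : Measurable (exponentialPDF s) :=
    (measurable_exponentialPDFReal s).ennreal_ofReal
  rw [hpdf, lintegral_withDensity_eq_lintegral_mul (g := fun t => discount (ENNReal.ofReal t)) _
    (hm r) (measurable_discount.comp ENNReal.measurable_ofReal)]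
  -- `exp (-t) * (r * exp (-r t))` is `r / (1 + r)` times the density of rate `1 + r`
  have key : ∀ t : ℝ, (exponentialPDF r * fun t => discount (ENNReal.ofReal t)) t
      = ((r / (1 + r) : ℝ≥0) : ℝ≥0∞) * exponentialPDF (1 + r) t := by
    intro t
    rw [Pi.mul_apply]
    rcases lt_or_ge t 0 with ht | ht
    · simp [exponentialPDF_of_neg ht]
    · rw [exponentialPDF_of_nonneg ht, exponentialPDF_of_nonneg ht, discount_ofReal ht,
        ← ENNReal.ofReal_mul (by positivity), ← ENNReal.ofReal_coe_nnreal,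
        ← ENNReal.ofReal_mul (by positivity)]
      congr 1
      have h1 : (1 + r : ℝ) ≠ 0 := by positivity
      push_cast
      rw [mul_assoc, ← Real.exp_add]
      field_simp
      ring_nf
  rw [lintegral_congr key, lintegral_const_mul _ (hm _),
    lintegral_exponentialPDF_eq_one (by positivity), mul_one]

/-- The operator `f ↦ E_x[exp (-σ) f (X(σ))]`, with `σ` the first jump time of the walk. -/
noncomputable def discountedStep (c : ℤ × ℤ → ℤ × ℤ → ℝ≥0) (f : ℤ × ℤ → ℝ≥0) (x : ℤ × ℤ) : ℝ≥0 :=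
  (∑ e ∈ unitSteps, c x (x + e) * f (x + e)) / (1 + totalRate c x)

lemma lintegral_jumpLaw (c : ℤ × ℤ → ℤ × ℤ → ℝ≥0) (f : ℤ × ℤ → ℝ≥0) (x : ℤ × ℤ)
    (h : totalRate c x ≠ 0) :
    ∫⁻ y, (f y : ℝ≥0∞) ∂(jumpLaw c x) =
      (((∑ e ∈ unitSteps, c x (x + e) * f (x + e)) / totalRate c x : ℝ≥0) : ℝ≥0∞) := by
  rw [jumpLaw, if_neg h, lintegral_finsetSum_measure, Finset.sum_div, ENNReal.ofNNReal_finsetSum]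
  refine Finset.sum_congr rfl fun e _ => ?_
  rw [lintegral_smul_measure, lintegral_dirac, smul_eq_mul, ← ENNReal.coe_mul]
  congr 1
  rw [div_mul_eq_mul_div]

lemma lintegral_stepKernel (c : ℤ × ℤ → ℤ × ℤ → ℝ≥0) (f : ℤ × ℤ → ℝ≥0) (x : ℤ × ℤ) :
    ∫⁻ p, discount p.1 * f p.2 ∂(stepKernel c x) = discountedStep c f x := by
  change ∫⁻ p, discount p.1 * f p.2 ∂((waitLaw (totalRate c x)).prod (jumpLaw c x)) = _
  rw [lintegral_prod_mul measurable_discount.aemeasurable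
    (measurable_of_countable fun y => (f y : ℝ≥0∞)).aemeasurable, lintegral_discount_waitLaw]
  by_cases h : totalRate c x = 0
  · have h0 : ∀ e ∈ unitSteps, c x (x + e) = 0 := by
      simpa [totalRate, Finset.sum_eq_zero_iff] using h
    have : discountedStep c f x = 0 := by
      rw [discountedStep, Finset.sum_eq_zero fun e he => by rw [h0 e he, zero_mul], zero_div]
    simp [h, this]
  · rw [lintegral_jumpLaw c f x h, ← ENNReal.coe_mul, discountedStep]
    congr 1
    field_simp

lemma measurable_jumpTime (n : ℕ) : Measurable fun γ : Trajectory => jumpTime γ n :=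
  Finset.measurable_sum _ fun k _ => measurable_fst.comp (measurable_pi_apply (k + 1))

/-- The trajectory that agrees with the history `z` up to the `n`-th jump. -/
def extendHistory {n : ℕ} (z : Π _ : Finset.Iic n, ℝ≥0∞ × (ℤ × ℤ)) : Trajectory :=
  fun k => if h : k ≤ n then z ⟨k, Finset.mem_Iic.mpr h⟩ else ((0 : ℝ≥0∞), ((0 : ℤ), (0 : ℤ)))

lemma measurable_extendHistory (n : ℕ) :
    Measurable (extendHistory : (Π _ : Finset.Iic n, ℝ≥0∞ × (ℤ × ℤ)) → Trajectory) := by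
  refine measurable_pi_lambda _ fun k => ?_
  unfold extendHistory
  split_ifs with h
  · exact measurable_pi_apply _
  · exact measurable_const

instance isProbabilityMeasure_walkLaw (c : ℤ × ℤ → ℤ × ℤ → ℝ≥0) :
    IsProbabilityMeasure (walkLaw c) := by
  unfold walkLaw
  infer_instance

/-- The history of a trajectory up to the `n`-th jump. -/
def history (n : ℕ) (γ : Trajectory) : Π _ : Finset.Iic n, ℝ≥0∞ × (ℤ × ℤ) :=
  Preorder.frestrictLe (π := fun _ => ℝ≥0∞ × (ℤ × ℤ)) n γ

lemma measurable_history (n : ℕ) : Measurable (history n) :=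
  Preorder.measurable_frestrictLe n

lemma jumpTime_extendHistory (γ : Trajectory) (n : ℕ) :
    jumpTime (extendHistory (history n γ)) n = jumpTime γ n := by
  refine Finset.sum_congr rfl fun k hk => ?_
  have : k + 1 ≤ n := Finset.mem_range.mp hk
  simp [extendHistory, history, this]

/-- The Markov property at the `n`-th jump: given the history, the next step has law
`historyKernel c n`. -/
lemma walkLaw_map_history_prod (c : ℤ × ℤ → ℤ × ℤ → ℝ≥0) (n : ℕ) :
    (walkLaw c).map (fun γ => (history n γ, γ (n + 1))) =
      ((walkLaw c).map (history n)) ⊗ₘ (historyKernel c n) := by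
  have h := Kernel.partialTraj_compProd_eq_map_traj
    (X := fun _ => ℝ≥0∞ × (ℤ × ℤ)) (κ := historyKernel c)
    (x₀ := fun _ => ((0 : ℝ≥0∞), ((0 : ℤ), (0 : ℤ)))) (Nat.zero_le n)
  rw [← Kernel.traj_map_frestrictLe_apply] at h
  exact h.symm

lemma lintegral_discount_jumpTime_succ (c : ℤ × ℤ → ℤ × ℤ → ℝ≥0) (f : ℤ × ℤ → ℝ≥0) (n : ℕ) :
    ∫⁻ γ, discount (jumpTime γ (n + 1)) * f (γ (n + 1)).2 ∂(walkLaw c) =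
      ∫⁻ γ, discount (jumpTime γ n) * discountedStep c f (γ n).2 ∂(walkLaw c) := by
  have hf (g : ℤ × ℤ → ℝ≥0) : Measurable fun y => (g y : ℝ≥0∞) := measurable_of_countable _
  have hp : Measurable fun p : ℝ≥0∞ × (ℤ × ℤ) => discount p.1 * f p.2 :=
    (measurable_discount.comp measurable_fst).mul ((hf f).comp measurable_snd)
  have hJ : Measurable fun z : Π _ : Finset.Iic n, ℝ≥0∞ × (ℤ × ℤ) =>
      discount (jumpTime (extendHistory z) n) :=
    measurable_discount.comp ((measurable_jumpTime n).comp (measurable_extendHistory n))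
  have hl : ∀ z : Π _ : Finset.Iic n, ℝ≥0∞ × (ℤ × ℤ),
      ∫⁻ p, discount (jumpTime (extendHistory z) n) * (discount p.1 * f p.2)
        ∂(historyKernel c n z) = discount (jumpTime (extendHistory z) n) *
          discountedStep c f (z ⟨n, Finset.mem_Iic.mpr le_rfl⟩).2 := by
    intro z
    rw [lintegral_const_mul _ hp, historyKernel, Kernel.comap_apply, lintegral_stepKernel]
  have hstep : Measurable fun z : Π _ : Finset.Iic n, ℝ≥0∞ × (ℤ × ℤ) =>
      discount (jumpTime (extendHistory z) n) *
        (discountedStep c f (z ⟨n, Finset.mem_Iic.mpr le_rfl⟩).2 : ℝ≥0∞) :=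
    hJ.mul ((hf _).comp (measurable_snd.comp (measurable_pi_apply _)))
  have hq : Measurable fun q : (Π _ : Finset.Iic n, ℝ≥0∞ × (ℤ × ℤ)) × (ℝ≥0∞ × (ℤ × ℤ)) =>
      discount (jumpTime (extendHistory q.1) n) * (discount q.2.1 * f q.2.2) :=
    (hJ.comp measurable_fst).mul (hp.comp measurable_snd)
  calc ∫⁻ γ, discount (jumpTime γ (n + 1)) * f (γ (n + 1)).2 ∂(walkLaw c)
      = ∫⁻ γ, discount (jumpTime (extendHistory (history n γ)) n) *
          (discount (γ (n + 1)).1 * f (γ (n + 1)).2) ∂(walkLaw c) := by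
        refine lintegral_congr fun γ => ?_
        rw [jumpTime_extendHistory, ← mul_assoc, ← discount_add, jumpTime,
          Finset.sum_range_succ, jumpTime]
    _ = ∫⁻ q, discount (jumpTime (extendHistory q.1) n) * (discount q.2.1 * f q.2.2)
          ∂((walkLaw c).map fun γ => (history n γ, γ (n + 1))) :=
        (lintegral_map hq ((measurable_history n).prodMk (measurable_pi_apply (n + 1)))).symm
    _ = ∫⁻ z, discount (jumpTime (extendHistory z) n) *
          discountedStep c f (z ⟨n, Finset.mem_Iic.mpr le_rfl⟩).2
            ∂((walkLaw c).map (history n)) := by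
        have : IsProbabilityMeasure ((walkLaw c).map (history n)) :=
          Measure.isProbabilityMeasure_map (measurable_history n).aemeasurable
        rw [walkLaw_map_history_prod, Measure.lintegral_compProd hq]
        exact lintegral_congr hl
    _ = ∫⁻ γ, discount (jumpTime γ n) * discountedStep c f (γ n).2 ∂(walkLaw c) := by
        rw [lintegral_map hstep (measurable_history n)]
        refine lintegral_congr fun γ => ?_
        rw [jumpTime_extendHistory]
        rfl

/-- The Laplace transform `E_x[exp (-J n)]` of the time `J n` of the `n`-th jump of the walk started
from `x`, defined through its recursion. -/
noncomputable def jumpLaplace (c : ℤ × ℤ → ℤ × ℤ → ℝ≥0) (n : ℕ) : ℤ × ℤ → ℝ≥0 :=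
  (discountedStep c)^[n] 1

lemma jumpLaplace_succ (c : ℤ × ℤ → ℤ × ℤ → ℝ≥0) (n : ℕ) :
    jumpLaplace c (n + 1) = discountedStep c (jumpLaplace c n) :=
  Function.iterate_succ_apply' _ _ _

lemma walkLaw_start (c : ℤ × ℤ → ℤ × ℤ → ℝ≥0) : ∀ᵐ γ ∂(walkLaw c), γ 0 = (0, (0, 0)) := by
  have h := Kernel.traj_map_frestrictLe_apply (X := fun _ => ℝ≥0∞ × (ℤ × ℤ))
    (κ := historyKernel c) 0 0 (fun _ => (0, (0, 0)))
  rw [Kernel.partialTraj_self, Kernel.id_apply] at h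
  have h' : (walkLaw c).map (history 0) = Measure.dirac fun _ => (0, (0, 0)) := h
  have h2 : ∀ᵐ z ∂((walkLaw c).map (history 0)),
      z ⟨0, Finset.mem_Iic.mpr le_rfl⟩ = ((0 : ℝ≥0∞), ((0 : ℤ), (0 : ℤ))) := by
    rw [h', ae_dirac_iff]
    exact measurable_pi_apply _ (measurableSet_singleton _)
  exact ae_of_ae_map (measurable_history 0).aemeasurable h2

lemma lintegral_discount_jumpTime (c : ℤ × ℤ → ℤ × ℤ → ℝ≥0) (n : ℕ) :
    ∫⁻ γ, discount (jumpTime γ n) ∂(walkLaw c) = jumpLaplace c n (0, 0) := by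
  suffices h : ∀ f : ℤ × ℤ → ℝ≥0, ∫⁻ γ, discount (jumpTime γ n) * f (γ n).2 ∂(walkLaw c) =
      (discountedStep c)^[n] f (0, 0) by
    simpa [jumpLaplace] using h 1
  induction n with
  | zero =>
    intro f
    have : ∀ᵐ γ ∂(walkLaw c), discount (jumpTime γ 0) * f (γ 0).2 = (f (0, 0) : ℝ≥0∞) := by
      filter_upwards [walkLaw_start c] with γ hγ
      rw [hγ]
      simp [jumpTime, discount_zero]
    rw [lintegral_congr_ae this]
    simp
  | succ n ih =>
    intro f
    rw [lintegral_discount_jumpTime_succ, ih, Function.iterate_succ_apply]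

/-- The walk does not explode if the Laplace transforms of its jump times tend to zero. -/
lemma ae_numJumps_lt_top {c : ℤ × ℤ → ℤ × ℤ → ℝ≥0}
    (h : ⨅ n, jumpLaplace c n (0, 0) = 0) :
    ∀ᵐ γ ∂(walkLaw c), ∀ t : ℝ≥0, numJumps γ t < ⊤ := by
  have hint : ∫⁻ γ, ⨅ n, discount (jumpTime γ n) ∂(walkLaw c) = 0 := by
    have hle : ∀ n, ∫⁻ γ, ⨅ n, discount (jumpTime γ n) ∂(walkLaw c)
        ≤ jumpLaplace c n (0, 0) := fun n =>
      (lintegral_mono fun γ => iInf_le _ n).trans_eq (lintegral_discount_jumpTime c n)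
    have := le_iInf hle
    rw [← ENNReal.coe_iInf, h] at this
    simpa using this
  have hmeas : Measurable fun γ : Trajectory => ⨅ n, discount (jumpTime γ n) :=
    Measurable.iInf fun n => measurable_discount.comp (measurable_jumpTime n)
  rw [lintegral_eq_zero_iff hmeas] at hint
  filter_upwards [hint] with γ hγ t
  obtain ⟨N, hN⟩ : ∃ N, (t : ℝ≥0∞) < jumpTime γ N := by
    by_contra! hcon
    have : discount t ≤ ⨅ n, discount (jumpTime γ n) :=
      le_iInf fun n => discount_le_iff.mpr (hcon n)
    rw [hγ] at this
    exact absurd (discount_pos (ENNReal.coe_ne_top (r := t))) (not_lt.mpr this)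
  unfold numJumps
  rw [Set.encard_lt_top_iff]
  refine (Set.finite_Iio N).subset fun n hn => ?_
  by_contra hnN
  have hmono : jumpTime γ N ≤ jumpTime γ n :=
    Finset.sum_le_sum_of_subset (Finset.range_mono (not_lt.mp hnN))
  exact absurd (hN.trans_le (hmono.trans hn.2)) (lt_irrefl _)

/-! ### The Laplace transform of the explosion time -/

/-- The Laplace transform `E_x[exp (-T)]` of the explosion time `T` of the walk started from `x`. -/
noncomputable def explosionLaplace (c : ℤ × ℤ → ℤ × ℤ → ℝ≥0) (x : ℤ × ℤ) : ℝ≥0 :=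
  ⨅ n, jumpLaplace c n x

lemma discountedStep_mono (c : ℤ × ℤ → ℤ × ℤ → ℝ≥0) : Monotone (discountedStep c) := by
  intro f g hfg x
  unfold discountedStep
  gcongr with e
  exact hfg _

lemma discountedStep_one_le (c : ℤ × ℤ → ℤ × ℤ → ℝ≥0) : discountedStep c 1 ≤ 1 := by
  intro x
  simp only [discountedStep, Pi.one_apply, mul_one]
  exact div_le_one_of_le₀ (le_add_of_nonneg_left zero_le_one) zero_le

lemma jumpLaplace_antitone (c : ℤ × ℤ → ℤ × ℤ → ℝ≥0) : Antitone (jumpLaplace c) :=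
  (discountedStep_mono c).antitone_iterate_of_map_le (discountedStep_one_le c)

lemma tendsto_jumpLaplace (c : ℤ × ℤ → ℤ × ℤ → ℝ≥0) (x : ℤ × ℤ) :
    Tendsto (fun n => jumpLaplace c n x) atTop (𝓝 (explosionLaplace c x)) :=
  tendsto_atTop_ciInf (fun _ _ h => jumpLaplace_antitone c h x) (OrderBot.bddBelow _)

lemma explosionLaplace_le_one (c : ℤ × ℤ → ℤ × ℤ → ℝ≥0) (x : ℤ × ℤ) :
    explosionLaplace c x ≤ 1 :=
  ciInf_le (OrderBot.bddBelow _) 0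

lemma discountedStep_explosionLaplace (c : ℤ × ℤ → ℤ × ℤ → ℝ≥0) :
    discountedStep c (explosionLaplace c) = explosionLaplace c := by
  ext1 x
  refine tendsto_nhds_unique ?_ ((tendsto_jumpLaplace c x).comp (tendsto_add_atTop_nat 1))
  simp only [Function.comp_def, jumpLaplace_succ, discountedStep]
  exact (tendsto_finsetSum _ fun e _ =>
    (tendsto_jumpLaplace c (x + e)).const_mul _).div_const _

/-- The generator equation `ℒ u = u` for `u x = E_x[exp (-T)]` in the line model. -/
lemma explosionLaplace_eq (H V : ℤ → ℝ≥0) (x y : ℤ) :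
    (explosionLaplace (conductance H V) (x, y) : ℝ) =
      H y * (explosionLaplace (conductance H V) (x + 1, y)
        + explosionLaplace (conductance H V) (x - 1, y)
        - 2 * explosionLaplace (conductance H V) (x, y)) +
      V x * (explosionLaplace (conductance H V) (x, y + 1)
        + explosionLaplace (conductance H V) (x, y - 1)
        - 2 * explosionLaplace (conductance H V) (x, y)) := by
  have h := congrFun (discountedStep_explosionLaplace (conductance H V)) (x, y)
  rw [discountedStep, div_eq_iff (by positivity)] at h
  simp only [totalRate, unitSteps, conductance, add_sub_cancel_left] at h
  rw [Finset.sum_insert (by decide), Finset.sum_insert (by decide), Finset.sum_insert (by decide),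
    Finset.sum_singleton, Finset.sum_insert (by decide), Finset.sum_insert (by decide),
    Finset.sum_insert (by decide), Finset.sum_singleton] at h
  simp at h
  have h' := congrArg (fun r : ℝ≥0 => (r : ℝ)) h
  push_cast at h'
  simp only [← sub_eq_add_neg] at h'
  linarith

/-! ### Averaging over boxes -/

/-- The second difference of `v`, averaged against the convolution of two boxes of side `n`. -/
lemma sum_sum_secondDiff (v : ℤ → ℝ) (n : ℕ) :
    ∑ i ∈ Finset.range n, ∑ j ∈ Finset.range n,
      (v ((i : ℤ) - j + 1) + v ((i : ℤ) - j - 1) - 2 * v ((i : ℤ) - j)) =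
        v n + v (-n) - 2 * v 0 := by
  have inner : ∀ i : ℕ, ∑ j ∈ Finset.range n,
      (v ((i : ℤ) - j + 1) + v ((i : ℤ) - j - 1) - 2 * v ((i : ℤ) - j)) =
        (v ((i : ℤ) - n) - v ((i : ℤ) - n + 1)) - (v i - v ((i : ℤ) + 1)) := by
    intro i
    have := Finset.sum_range_sub (fun j : ℕ => v ((i : ℤ) - j) - v ((i : ℤ) - j + 1)) n
    simp only [Nat.cast_zero, sub_zero] at this
    rw [← this]
    refine Finset.sum_congr rfl fun j _ => ?_
    rw [show (i : ℤ) - (j + 1 : ℕ) = i - j - 1 by push_cast; ring,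
      show (i : ℤ) - j - 1 + 1 = i - j by ring]
    ring
  simp only [inner]
  have := Finset.sum_range_sub (fun i : ℕ => v i - v ((i : ℤ) - n)) n
  simp only [Nat.cast_zero, sub_self, zero_sub] at this
  rw [show v n + v (-n) - 2 * v 0 = v n - v 0 - (v 0 - v (-n)) by ring, ← this]
  refine Finset.sum_congr rfl fun i _ => ?_
  rw [show ((i + 1 : ℕ) : ℤ) - n = i - n + 1 by push_cast; ring]
  push_cast
  ring

lemma sum_sum_secondDiff_le {v : ℤ → ℝ} (h0 : ∀ k, 0 ≤ v k) (h1 : ∀ k, v k ≤ 1) (n : ℕ) :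
    ∑ i ∈ Finset.range n, ∑ j ∈ Finset.range n,
      (v ((i : ℤ) - j + 1) + v ((i : ℤ) - j - 1) - 2 * v ((i : ℤ) - j)) ≤ 2 := by
  rw [sum_sum_secondDiff]
  linarith [h0 0, h1 n, h1 (-n)]

lemma sum_sum_sub_le (f : ℤ → ℝ≥0) (n : ℕ) :
    ∑ i ∈ Finset.range n, ∑ j ∈ Finset.range n, f ((i : ℤ) - j) ≤
      n * ∑ k ∈ Finset.Icc (-n : ℤ) n, f k := by
  calc ∑ i ∈ Finset.range n, ∑ j ∈ Finset.range n, f ((i : ℤ) - j)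
      ≤ ∑ i ∈ Finset.range n, ∑ k ∈ Finset.Icc (-n : ℤ) n, f k := by
        refine Finset.sum_le_sum fun i hi => ?_
        rw [← Finset.sum_image (f := f) (g := fun j : ℕ => (i : ℤ) - j)
          (fun a _ b _ hab => by simpa using hab)]
        refine Finset.sum_le_sum_of_subset fun k hk => ?_
        simp only [Finset.mem_image, Finset.mem_range, Finset.mem_Icc] at hk hi ⊢
        omega
    _ = n * ∑ k ∈ Finset.Icc (-n : ℤ) n, f k := by simp

/-- The sum of `u x = E_x[exp (-T)]` over differences of points of an `m × n` box is controlled by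
the boundary terms of a summation by parts, in which only linear sums of the conductances occur. -/
lemma sum_explosionLaplace_le (H V : ℤ → ℝ≥0) (m n : ℕ) :
    ∑ i ∈ Finset.range m, ∑ j ∈ Finset.range m, ∑ k ∈ Finset.range n, ∑ l ∈ Finset.range n,
      explosionLaplace (conductance H V) ((i : ℤ) - j, (k : ℤ) - l) ≤
        2 * n * ∑ y ∈ Finset.Icc (-n : ℤ) n, H y + 2 * m * ∑ x ∈ Finset.Icc (-m : ℤ) m, V x := by
  set u : ℤ × ℤ → ℝ≥0 := explosionLaplace (conductance H V) with hu
  have hu0 : ∀ x, 0 ≤ (u x : ℝ) := fun x => (u x).2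
  have hu1 : ∀ x, (u x : ℝ) ≤ 1 := fun x => by exact_mod_cast explosionLaplace_le_one _ x
  have hH : ∑ k ∈ Finset.range n, ∑ l ∈ Finset.range n,
      ∑ i ∈ Finset.range m, ∑ j ∈ Finset.range m, (H ((k : ℤ) - l) : ℝ) *
        (u ((i : ℤ) - j + 1, (k : ℤ) - l) + u ((i : ℤ) - j - 1, (k : ℤ) - l)
          - 2 * u ((i : ℤ) - j, (k : ℤ) - l)) ≤
      ∑ k ∈ Finset.range n, ∑ l ∈ Finset.range n, (H ((k : ℤ) - l) : ℝ) * 2 := by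
    refine Finset.sum_le_sum fun k _ => Finset.sum_le_sum fun l _ => ?_
    simp only [← Finset.mul_sum]
    exact mul_le_mul_of_nonneg_left (sum_sum_secondDiff_le (v := fun x => (u (x, (k : ℤ) - l) : ℝ))
      (fun x => hu0 _) (fun x => hu1 _) m) (H _).2
  have hV : ∑ i ∈ Finset.range m, ∑ j ∈ Finset.range m,
      ∑ k ∈ Finset.range n, ∑ l ∈ Finset.range n, (V ((i : ℤ) - j) : ℝ) *
        (u ((i : ℤ) - j, (k : ℤ) - l + 1) + u ((i : ℤ) - j, (k : ℤ) - l - 1)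
          - 2 * u ((i : ℤ) - j, (k : ℤ) - l)) ≤
      ∑ i ∈ Finset.range m, ∑ j ∈ Finset.range m, (V ((i : ℤ) - j) : ℝ) * 2 := by
    refine Finset.sum_le_sum fun i _ => Finset.sum_le_sum fun j _ => ?_
    simp only [← Finset.mul_sum]
    exact mul_le_mul_of_nonneg_left (sum_sum_secondDiff_le (v := fun y => (u ((i : ℤ) - j, y) : ℝ))
      (fun x => hu0 _) (fun x => hu1 _) n) (V _).2
  -- the sums over rows and over columns are interchanged in the horizontal part
  have hswap (F : ℕ → ℕ → ℕ → ℕ → ℝ) :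
      ∑ i ∈ Finset.range m, ∑ j ∈ Finset.range m, ∑ k ∈ Finset.range n, ∑ l ∈ Finset.range n,
        F i j k l = ∑ k ∈ Finset.range n, ∑ l ∈ Finset.range n,
          ∑ i ∈ Finset.range m, ∑ j ∈ Finset.range m, F i j k l := by
    exact (Finset.sum_congr rfl fun i _ => Finset.sum_comm.trans
      (Finset.sum_congr rfl fun k _ => Finset.sum_comm)).trans
      (Finset.sum_comm.trans (Finset.sum_congr rfl fun k _ => Finset.sum_comm))
  have hsum : (∑ i ∈ Finset.range m, ∑ j ∈ Finset.range m, ∑ k ∈ Finset.range n,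
      ∑ l ∈ Finset.range n, (u ((i : ℤ) - j, (k : ℤ) - l) : ℝ)) ≤
      ∑ k ∈ Finset.range n, ∑ l ∈ Finset.range n, (H ((k : ℤ) - l) : ℝ) * 2 +
      ∑ i ∈ Finset.range m, ∑ j ∈ Finset.range m, (V ((i : ℤ) - j) : ℝ) * 2 := by
    refine le_trans (le_of_eq ?_) (add_le_add hH hV)
    rw [← hswap]
    simp only [← Finset.sum_add_distrib]
    exact Finset.sum_congr rfl fun i _ => Finset.sum_congr rfl fun j _ =>
      Finset.sum_congr rfl fun k _ => Finset.sum_congr rfl fun l _ => explosionLaplace_eq H V _ _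
  have hHle := sum_sum_sub_le H n
  have hVle := sum_sum_sub_le V m
  rw [← NNReal.coe_le_coe] at hHle hVle ⊢
  push_cast at hHle hVle ⊢
  simp only [← Finset.sum_mul] at hsum
  linarith

/-! ### Stationarity of the environment -/

lemma conductance_shift (H V : ℤ → ℝ≥0) (a x y : ℤ × ℤ) :
    conductance H V (a + x) (a + y) =
      conductance (fun k => H (a.2 + k)) (fun k => V (a.1 + k)) x y := by
  simp only [conductance, add_sub_add_left_eq_sub, Prod.snd_add, Prod.fst_add]

lemma jumpLaplace_shift (H V : ℤ → ℝ≥0) (a : ℤ × ℤ) (n : ℕ) (x : ℤ × ℤ) :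
    jumpLaplace (conductance H V) n (a + x) =
      jumpLaplace (conductance (fun k => H (a.2 + k)) (fun k => V (a.1 + k))) n x := by
  induction n generalizing x with
  | zero => rfl
  | succ n ih =>
    simp only [jumpLaplace_succ, discountedStep, totalRate, add_assoc, conductance_shift, ih]

lemma measurable_conductance (x y : ℤ × ℤ) :
    Measurable fun p : (ℤ → ℝ≥0) × (ℤ → ℝ≥0) => conductance p.1 p.2 x y := by
  unfold conductance
  split_ifs
  · exact (measurable_pi_apply _).comp measurable_fst
  · exact (measurable_pi_apply _).comp measurable_snd
  · exact measurable_const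

lemma measurable_jumpLaplace (n : ℕ) (x : ℤ × ℤ) :
    Measurable fun p : (ℤ → ℝ≥0) × (ℤ → ℝ≥0) => jumpLaplace (conductance p.1 p.2) n x := by
  induction n generalizing x with
  | zero => exact measurable_const
  | succ n ih =>
    simp only [jumpLaplace_succ, discountedStep, totalRate]
    exact (Finset.measurable_sum _ fun e _ => (measurable_conductance _ _).mul (ih _)).div
      (measurable_const.add (Finset.measurable_sum _ fun e _ => measurable_conductance _ _))

lemma measurable_explosionLaplace (x : ℤ × ℤ) :
    Measurable fun p : (ℤ → ℝ≥0) × (ℤ → ℝ≥0) => explosionLaplace (conductance p.1 p.2) x :=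
  Measurable.iInf fun n => measurable_jumpLaplace n x

lemma explosionLaplace_shift (H V : ℤ → ℝ≥0) (a : ℤ × ℤ) :
    explosionLaplace (conductance H V) a =
      explosionLaplace (conductance (fun k => H (a.2 + k)) (fun k => V (a.1 + k))) (0, 0) := by
  unfold explosionLaplace
  refine iInf_congr fun n => ?_
  rw [← jumpLaplace_shift, Prod.mk_zero_zero, add_zero]

section Stationary

variable {Ω : Type*} [MeasurableSpace Ω] {μ : Measure Ω}

/-- The law of an i.i.d. family indexed by `ℤ` is invariant under translations. -/
lemma map_shift_of_iid [IsProbabilityMeasure μ] {H : ℤ → Ω → ℝ≥0} (hmeas : ∀ k, Measurable (H k)) (hindep : iIndepFun H μ)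
    (hident : ∀ k, IdentDistrib (H k) (H 0) μ μ) (a : ℤ) :
    μ.map (fun ω k => H (a + k) ω) = μ.map (fun ω k => H k ω) := by
  rw [(iIndepFun_iff_map_fun_eq_infinitePi_map hmeas).mp hindep,
    (iIndepFun_iff_map_fun_eq_infinitePi_map fun k => hmeas (a + k)).mp
      (hindep.precomp (add_right_injective a))]
  congr 1
  funext k
  rw [(hident (a + k)).map_eq, (hident k).map_eq]

/-- The expectation of `E_x[exp (-T)]` over the environment does not depend on `x`. -/
lemma lintegral_explosionLaplace_eq [IsProbabilityMeasure μ] {H V : ℤ → Ω → ℝ≥0}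
    (hHmeas : ∀ k, Measurable (H k)) (hVmeas : ∀ k, Measurable (V k))
    (hHindep : iIndepFun H μ) (hHident : ∀ k, IdentDistrib (H k) (H 0) μ μ)
    (hVindep : iIndepFun V μ) (hVident : ∀ k, IdentDistrib (V k) (V 0) μ μ)
    (hHV : IndepFun (fun ω k => H k ω) (fun ω k => V k ω) μ) (x : ℤ × ℤ) :
    ∫⁻ ω, explosionLaplace (conductance (fun k => H k ω) (fun k => V k ω)) x ∂μ =
      ∫⁻ ω, explosionLaplace (conductance (fun k => H k ω) (fun k => V k ω)) (0, 0) ∂μ := by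
  have hH (a : ℤ) : Measurable fun ω k => H (a + k) ω :=
    measurable_pi_lambda _ fun k => hHmeas (a + k)
  have hV (a : ℤ) : Measurable fun ω k => V (a + k) ω :=
    measurable_pi_lambda _ fun k => hVmeas (a + k)
  have hH0 : Measurable fun ω k => H k ω := measurable_pi_lambda _ hHmeas
  have hV0 : Measurable fun ω k => V k ω := measurable_pi_lambda _ hVmeas
  have hshift (a : ℤ) : Measurable fun (f : ℤ → ℝ≥0) k => f (a + k) :=
    measurable_pi_lambda _ fun k => measurable_pi_apply (a + k)
  have hlaw : μ.map (fun ω => ((fun k => H (x.2 + k) ω), (fun k => V (x.1 + k) ω))) =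
      μ.map (fun ω => ((fun k => H k ω), (fun k => V k ω))) := by
    rw [(indepFun_iff_map_prod_eq_prod_map_map hH0.aemeasurable hV0.aemeasurable).mp hHV,
      (indepFun_iff_map_prod_eq_prod_map_map (hH x.2).aemeasurable (hV x.1).aemeasurable).mp
        (hHV.comp (hshift x.2) (hshift x.1)),
      map_shift_of_iid hHmeas hHindep hHident, map_shift_of_iid hVmeas hVindep hVident]
  have hm : Measurable fun p : (ℤ → ℝ≥0) × (ℤ → ℝ≥0) =>
      (explosionLaplace (conductance p.1 p.2) (0, 0) : ℝ≥0∞) :=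
    (measurable_explosionLaplace (0, 0)).coe_nnreal_ennreal
  simp only [explosionLaplace_shift _ _ x]
  rw [← lintegral_map hm ((hH x.2).prodMk (hV x.1)), hlaw, lintegral_map hm (hH0.prodMk hV0)]

/-! ### Fractional moments -/

/-- A random variable whose tail decays with exponent `α` has finite moments of all orders
`p < α`. -/
lemma lintegral_rpow_lt_top_of_tail [IsProbabilityMeasure μ] {X : Ω → ℝ≥0} (hX : Measurable X) {α p K : ℝ}
    (hp : 0 < p) (hpα : p < α)
    (htail : ∃ o : ℝ → ℝ, Tendsto o atTop (𝓝 0) ∧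
      ∀ᶠ L : ℝ in atTop, μ.real {ω | L < (X ω : ℝ)} = K * L ^ (-α * (1 + o L))) :
    ∫⁻ ω, (X ω : ℝ≥0∞) ^ p ∂μ < ∞ := by
  obtain ⟨o, ho, htail⟩ := htail
  obtain ⟨q, hpq, hqα⟩ := exists_between hpα
  have hα : 0 < α := hp.trans hpα
  have hexp : ∀ᶠ L in atTop, -α * (1 + o L) ≤ -q := by
    have h1 : Tendsto (fun L => -α * (1 + o L)) atTop (𝓝 (-α * (1 + 0))) :=
      (ho.const_add 1).const_mul _
    exact (h1.eventually (gt_mem_nhds (by linarith))).mono fun _ h => h.le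
  obtain ⟨A, hA1, hA⟩ : ∃ A : ℝ, 1 ≤ A ∧ ∀ t, A ≤ t →
      μ.real {ω | t < (X ω : ℝ)} ≤ |K| * t ^ (-q) := by
    obtain ⟨A, hA⟩ := eventually_atTop.mp (hexp.and htail)
    refine ⟨max A 1, le_max_right _ _, fun t ht => ?_⟩
    obtain ⟨h1, h2⟩ := hA t ((le_max_left _ _).trans ht)
    have ht1 : 1 ≤ t := (le_max_right _ _).trans ht
    rw [h2]
    exact mul_le_mul (le_abs_self K) (Real.rpow_le_rpow_of_exponent_le ht1 h1)
      (by positivity) (abs_nonneg K)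
  have hA0 : 0 < A := by linarith
  have hconv : ∫⁻ ω, (X ω : ℝ≥0∞) ^ p ∂μ = ∫⁻ ω, ENNReal.ofReal ((X ω : ℝ) ^ p) ∂μ := by
    refine lintegral_congr fun ω => ?_
    rw [← ENNReal.ofReal_rpow_of_nonneg (X ω).coe_nonneg hp.le, ENNReal.ofReal_coe_nnreal]
  rw [hconv, lintegral_rpow_eq_lintegral_meas_lt_mul μ (ae_of_all _ fun ω => (X ω).coe_nonneg)
    hX.coe_nnreal_real.aemeasurable hp]
  refine ENNReal.mul_lt_top ENNReal.ofReal_lt_top ?_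
  rw [← Set.Ioc_union_Ioi_eq_Ioi hA0.le]
  refine (lintegral_union_le _ _ _).trans_lt (ENNReal.add_lt_top.mpr ⟨?_, ?_⟩)
  · have hint : IntegrableOn (fun t : ℝ => t ^ (p - 1)) (Set.Ioc 0 A) := by
      rw [← intervalIntegrable_iff_integrableOn_Ioc_of_le hA0.le]
      exact intervalIntegral.intervalIntegrable_rpow' (by linarith)
    refine (lintegral_mono fun t => ?_).trans_lt hint.lintegral_lt_top
    exact (mul_le_mul_left prob_le_one _).trans_eq (one_mul _)
  · have hint : IntegrableOn (fun t : ℝ => |K| * t ^ (p - q - 1)) (Set.Ioi A) :=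
      (integrableOn_Ioi_rpow_of_lt (by linarith) hA0).const_mul _
    refine (setLIntegral_mono_ae' measurableSet_Ioi
      (ae_of_all _ fun t (ht : A < t) => ?_)).trans_lt hint.lintegral_lt_top
    have ht0 : 0 < t := hA0.trans ht
    rw [← ENNReal.ofReal_toReal (measure_ne_top μ {a | t < (X a : ℝ)}),
      ← ENNReal.ofReal_mul ENNReal.toReal_nonneg]
    refine ENNReal.ofReal_le_ofReal ?_
    calc (μ {a | t < (X a : ℝ)}).toReal * t ^ (p - 1)
        ≤ |K| * t ^ (-q) * t ^ (p - 1) := by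
          gcongr
          exact hA t ht.le
      _ = |K| * t ^ (p - q - 1) := by
          rw [mul_assoc, ← Real.rpow_add ht0]
          ring_nf

/-- Subadditivity of `t ↦ t ^ p` for `p ≤ 1`, over a finite sum. -/
lemma sum_rpow_le_of_le_one {ι : Type*} (s : Finset ι) (f : ι → ℝ≥0∞) {p : ℝ} (hp : 0 < p)
    (hp1 : p ≤ 1) : (∑ i ∈ s, f i) ^ p ≤ ∑ i ∈ s, f i ^ p := by
  classical
  induction s using Finset.induction_on with
  | empty => simp [hp]
  | insert a s ha ih =>
    rw [Finset.sum_insert ha, Finset.sum_insert ha]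
    exact (ENNReal.rpow_add_le_add_rpow _ _ hp.le hp1).trans (add_le_add le_rfl ih)

lemma lintegral_sum_rpow_le {H : ℤ → Ω → ℝ≥0} (hmeas : ∀ k, Measurable (H k))
    (hident : ∀ k, IdentDistrib (H k) (H 0) μ μ) {p : ℝ} (hp : 0 < p) (hp1 : p ≤ 1) (n : ℕ) :
    ∫⁻ ω, (∑ k ∈ Finset.Icc (-n : ℤ) n, (H k ω : ℝ≥0∞)) ^ p ∂μ ≤
      (2 * n + 1 : ℕ) * ∫⁻ ω, (H 0 ω : ℝ≥0∞) ^ p ∂μ := by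
  have hm (k : ℤ) : Measurable fun ω => (H k ω : ℝ≥0∞) ^ p :=
    (hmeas k).coe_nnreal_ennreal.pow_const p
  have hpow : Measurable fun r : ℝ≥0 => (r : ℝ≥0∞) ^ p :=
    measurable_coe_nnreal_ennreal.pow_const p
  calc ∫⁻ ω, (∑ k ∈ Finset.Icc (-n : ℤ) n, (H k ω : ℝ≥0∞)) ^ p ∂μ
      ≤ ∫⁻ ω, ∑ k ∈ Finset.Icc (-n : ℤ) n, (H k ω : ℝ≥0∞) ^ p ∂μ :=
        lintegral_mono fun ω => sum_rpow_le_of_le_one _ _ hp hp1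
    _ = ∑ k ∈ Finset.Icc (-n : ℤ) n, ∫⁻ ω, (H 0 ω : ℝ≥0∞) ^ p ∂μ := by
        rw [lintegral_finsetSum _ fun k _ => hm k]
        exact Finset.sum_congr rfl fun k _ => ((hident k).comp hpow).lintegral_eq
    _ = (2 * n + 1 : ℕ) * ∫⁻ ω, (H 0 ω : ℝ≥0∞) ^ p ∂μ := by
        rw [Finset.sum_const, nsmul_eq_mul, Int.card_Icc]
        congr 2
        omega

end Stationary

/-! ### Large boxes -/

/-- Domination of a quantity bounded by `1` by powers with different exponents. -/
lemma le_rpow_add_rpow {s a b : ℝ≥0∞} (hs : s ≤ 1) (hab : s ≤ a + b) {p q : ℝ} (hp : 0 < p)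
    (hp1 : p ≤ 1) (hq : 0 < q) (hq1 : q ≤ 1) : s ≤ a ^ p + b ^ q := by
  have key : ∀ {t : ℝ≥0∞} {r : ℝ}, 0 < r → r ≤ 1 → t ≤ 1 → t ≤ t ^ r := by
    intro t r _ hr1 ht
    simpa using ENNReal.rpow_le_rpow_of_exponent_ge ht hr1
  rcases le_total a 1 with ha | ha
  · rcases le_total b 1 with hb | hb
    · exact hab.trans (add_le_add (key hp hp1 ha) (key hq hq1 hb))
    · exact hs.trans ((ENNReal.one_le_rpow hb hq).trans le_add_self)
  · exact hs.trans ((ENNReal.one_le_rpow ha hp).trans le_self_add)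

lemma lintegral_sum_box {Ω : Type*} [MeasurableSpace Ω] {μ : Measure Ω} {f : ℤ × ℤ → Ω → ℝ≥0∞}
    (hf : ∀ x, Measurable (f x)) {C : ℝ≥0∞} (hC : ∀ x, ∫⁻ ω, f x ω ∂μ = C) (m n : ℕ) :
    ∫⁻ ω, ∑ i ∈ Finset.range m, ∑ j ∈ Finset.range m, ∑ k ∈ Finset.range n, ∑ l ∈ Finset.range n,
      f ((i : ℤ) - j, (k : ℤ) - l) ω ∂μ = m ^ 2 * n ^ 2 * C := by
  have h1 (i j k : ℕ) : Measurable fun ω =>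
      ∑ l ∈ Finset.range n, f ((i : ℤ) - j, (k : ℤ) - l) ω :=
    Finset.measurable_sum _ fun l _ => hf _
  have h2 (i j : ℕ) : Measurable fun ω =>
      ∑ k ∈ Finset.range n, ∑ l ∈ Finset.range n, f ((i : ℤ) - j, (k : ℤ) - l) ω :=
    Finset.measurable_sum _ fun k _ => h1 i j k
  have h3 (i : ℕ) : Measurable fun ω =>
      ∑ j ∈ Finset.range m, ∑ k ∈ Finset.range n, ∑ l ∈ Finset.range n,
        f ((i : ℤ) - j, (k : ℤ) - l) ω :=
    Finset.measurable_sum _ fun j _ => h2 i j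
  rw [lintegral_finsetSum _ fun i _ => h3 i]
  simp_rw [lintegral_finsetSum _ fun j _ => h2 _ j, lintegral_finsetSum _ fun k _ => h1 _ _ k,
    lintegral_finsetSum _ fun l _ => hf _, hC, Finset.sum_const, Finset.card_range, nsmul_eq_mul]
  ring

/-- The average of `x ↦ E_x[exp (-T)]` over the differences `x` of two independent uniform points of
an `m × n` box. Averaging over differences instead of points turns the uniform weights into tents,
which are concave and vanish at the boundary. -/
noncomputable def boxAverage (H V : ℤ → ℝ≥0) (m n : ℕ) : ℝ≥0 :=
  (∑ i ∈ Finset.range m, ∑ j ∈ Finset.range m, ∑ k ∈ Finset.range n, ∑ l ∈ Finset.range n,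
    explosionLaplace (conductance H V) ((i : ℤ) - j, (k : ℤ) - l)) / (m ^ 2 * n ^ 2)

lemma boxAverage_le_one (H V : ℤ → ℝ≥0) (m n : ℕ) : boxAverage H V m n ≤ 1 := by
  refine div_le_one_of_le₀ ?_ zero_le
  calc _ ≤ ∑ i ∈ Finset.range m, ∑ j ∈ Finset.range m, ∑ k ∈ Finset.range n,
        ∑ l ∈ Finset.range n, (1 : ℝ≥0) :=
        Finset.sum_le_sum fun i _ => Finset.sum_le_sum fun j _ => Finset.sum_le_sum fun k _ =>
          Finset.sum_le_sum fun l _ => explosionLaplace_le_one _ _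
    _ = m ^ 2 * n ^ 2 := by
        simp only [Finset.sum_const, Finset.card_range, nsmul_eq_mul, mul_one]
        ring

lemma boxAverage_le (H V : ℤ → ℝ≥0) {m n : ℕ} (hm : 0 < m) (hn : 0 < n) :
    boxAverage H V m n ≤ 2 / (m ^ 2 * n) * ∑ k ∈ Finset.Icc (-n : ℤ) n, H k +
      2 / (n ^ 2 * m) * ∑ k ∈ Finset.Icc (-m : ℤ) m, V k := by
  rw [boxAverage, div_le_iff₀ (by positivity)]
  refine (sum_explosionLaplace_le _ _ m n).trans_eq ?_
  have hm' : (m : ℝ≥0) ≠ 0 := by positivity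
  have hn' : (n : ℝ≥0) ≠ 0 := by positivity
  field_simp

/-- The mean of the box average is the mean of `E_0[exp (-T)]`. -/
lemma lintegral_boxAverage {Ω : Type*} [MeasurableSpace Ω] {μ : Measure Ω}
    [IsProbabilityMeasure μ] {H V : ℤ → Ω → ℝ≥0}
    (hHmeas : ∀ k, Measurable (H k)) (hVmeas : ∀ k, Measurable (V k))
    (hHindep : iIndepFun H μ) (hHident : ∀ k, IdentDistrib (H k) (H 0) μ μ)
    (hVindep : iIndepFun V μ) (hVident : ∀ k, IdentDistrib (V k) (V 0) μ μ)
    (hHV : IndepFun (fun ω k => H k ω) (fun ω k => V k ω) μ) {m n : ℕ} (hm : 0 < m) (hn : 0 < n) :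
    ∫⁻ ω, boxAverage (fun k => H k ω) (fun k => V k ω) m n ∂μ =
      ∫⁻ ω, explosionLaplace (conductance (fun k => H k ω) (fun k => V k ω)) (0, 0) ∂μ := by
  have hmn : (m ^ 2 * n ^ 2 : ℝ≥0) ≠ 0 := by positivity
  have hmeas (x : ℤ × ℤ) : Measurable fun ω =>
      (explosionLaplace (conductance (fun k => H k ω) (fun k => V k ω)) x : ℝ≥0∞) :=
    ((measurable_explosionLaplace x).comp ((measurable_pi_lambda _ hHmeas).prodMk
      (measurable_pi_lambda _ hVmeas))).coe_nnreal_ennreal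
  have hbox := lintegral_sum_box hmeas (lintegral_explosionLaplace_eq hHmeas hVmeas hHindep hHident
    hVindep hVident hHV) m n
  simp only [boxAverage, div_eq_inv_mul, ENNReal.coe_mul, ENNReal.ofNNReal_finsetSum]
  rw [lintegral_const_mul' _ _ ENNReal.coe_ne_top, hbox,
    show (m ^ 2 * n ^ 2 : ℝ≥0∞) = ((m ^ 2 * n ^ 2 : ℝ≥0) : ℝ≥0∞) by push_cast; rfl, ← mul_assoc,
    ← ENNReal.coe_mul, inv_mul_cancel₀ hmn, ENNReal.coe_one, one_mul]

/-- The bound on the mean of `E_0[exp (-T)]` obtained from boxes of sides `m` and `n`, in terms of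
fractional moments of the conductances. -/
lemma lintegral_explosionLaplace_le {Ω : Type*} [MeasurableSpace Ω] {μ : Measure Ω}
    [IsProbabilityMeasure μ] {H V : ℤ → Ω → ℝ≥0}
    (hHmeas : ∀ k, Measurable (H k)) (hVmeas : ∀ k, Measurable (V k))
    (hHindep : iIndepFun H μ) (hHident : ∀ k, IdentDistrib (H k) (H 0) μ μ)
    (hVindep : iIndepFun V μ) (hVident : ∀ k, IdentDistrib (V k) (V 0) μ μ)
    (hHV : IndepFun (fun ω k => H k ω) (fun ω k => V k ω) μ)
    {p q : ℝ} (hp : 0 < p) (hp1 : p ≤ 1) (hq : 0 < q) (hq1 : q ≤ 1) {m n : ℕ}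
    (hm : 0 < m) (hn : 0 < n) :
    ∫⁻ ω, explosionLaplace (conductance (fun k => H k ω) (fun k => V k ω)) (0, 0) ∂μ ≤
      ((2 / (m ^ 2 * n) : ℝ≥0) : ℝ≥0∞) ^ p * ((2 * n + 1 : ℕ) * ∫⁻ ω, (H 0 ω : ℝ≥0∞) ^ p ∂μ) +
      ((2 / (n ^ 2 * m) : ℝ≥0) : ℝ≥0∞) ^ q *
        ((2 * m + 1 : ℕ) * ∫⁻ ω, (V 0 ω : ℝ≥0∞) ^ q ∂μ) := by
  have hpoint : ∀ ω, (boxAverage (fun k => H k ω) (fun k => V k ω) m n : ℝ≥0∞) ≤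
      ((2 / (m ^ 2 * n) : ℝ≥0) * ∑ k ∈ Finset.Icc (-n : ℤ) n, (H k ω : ℝ≥0∞)) ^ p +
      ((2 / (n ^ 2 * m) : ℝ≥0) * ∑ k ∈ Finset.Icc (-m : ℤ) m, (V k ω : ℝ≥0∞)) ^ q := by
    intro ω
    refine le_rpow_add_rpow ?_ ?_ hp hp1 hq hq1
    · exact_mod_cast boxAverage_le_one _ _ m n
    · rw [← ENNReal.ofNNReal_finsetSum, ← ENNReal.ofNNReal_finsetSum, ← ENNReal.coe_mul,
        ← ENNReal.coe_mul, ← ENNReal.coe_add, ENNReal.coe_le_coe]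
      exact boxAverage_le _ _ hm hn
  have hsum {F : ℤ → Ω → ℝ≥0} (hF : ∀ k, Measurable (F k)) (s : Finset ℤ) (r : ℝ) :
      Measurable fun ω => (∑ k ∈ s, (F k ω : ℝ≥0∞)) ^ r :=
    (Finset.measurable_sum _ fun k _ => (hF k).coe_nnreal_ennreal).pow_const r
  rw [← lintegral_boxAverage hHmeas hVmeas hHindep hHident hVindep hVident hHV hm hn]
  refine (lintegral_mono hpoint).trans ?_
  simp only [ENNReal.mul_rpow_of_nonneg _ _ hp.le, ENNReal.mul_rpow_of_nonneg _ _ hq.le]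
  rw [lintegral_add_left ((hsum hHmeas _ p).const_mul _), lintegral_const_mul _ (hsum hHmeas _ p),
    lintegral_const_mul _ (hsum hVmeas _ q)]
  exact add_le_add (mul_le_mul_right (lintegral_sum_rpow_le hHmeas hHident hp hp1 n) _)
    (mul_le_mul_right (lintegral_sum_rpow_le hVmeas hVident hq hq1 m) _)

/-- If `1 - p - 2 a p < 0`, the coefficient of the horizontal moment vanishes along boxes of sides
`⌈n ^ a⌉` and `n`. -/
lemma tendsto_coeff_fst {a p : ℝ} (hp : 0 < p) (h : 1 - p - 2 * a * p < 0) :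
    Tendsto (fun n : ℕ => ((2 / ((⌈(n : ℝ) ^ a⌉₊ : ℕ) ^ 2 * n) : ℝ≥0) : ℝ≥0∞) ^ p *
      ((2 * n + 1 : ℕ) : ℝ≥0∞)) atTop (𝓝 0) := by
  have hlim : Tendsto (fun n : ℕ => ENNReal.ofReal (2 ^ p * 3 * (n : ℝ) ^ (1 - p - 2 * a * p)))
      atTop (𝓝 0) := by
    have := (tendsto_rpow_neg_atTop (y := -(1 - p - 2 * a * p)) (by linarith)).comp
      (tendsto_natCast_atTop_atTop (R := ℝ))
    have h2 := ENNReal.tendsto_ofReal (this.const_mul (2 ^ p * 3 : ℝ))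
    simpa [Function.comp_def] using h2
  refine tendsto_of_tendsto_of_tendsto_of_le_of_le' tendsto_const_nhds hlim
    (Eventually.of_forall fun _ => zero_le) ?_
  filter_upwards [eventually_ge_atTop 1] with n hn
  have hn1 : (1 : ℝ) ≤ n := by exact_mod_cast hn
  have hn0 : (0 : ℝ) < n := by linarith
  have hm : (n : ℝ) ^ a ≤ (⌈(n : ℝ) ^ a⌉₊ : ℕ) := Nat.le_ceil _
  have ha : 0 < (n : ℝ) ^ a := Real.rpow_pos_of_pos hn0 a
  rw [← ENNReal.coe_rpow_of_nonneg _ hp.le, ← ENNReal.coe_natCast, ← ENNReal.coe_mul,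
    ← ENNReal.ofReal_coe_nnreal]
  refine ENNReal.ofReal_le_ofReal ?_
  push_cast
  calc (2 / ((⌈(n : ℝ) ^ a⌉₊ : ℝ) ^ 2 * n)) ^ p * (2 * n + 1)
      ≤ (2 / (((n : ℝ) ^ a) ^ 2 * n)) ^ p * (3 * n) := by
        gcongr
        linarith
    _ = 2 ^ p * 3 * (n : ℝ) ^ (1 - p - 2 * a * p) := by
        rw [Real.div_rpow (by norm_num) (by positivity), Real.mul_rpow (by positivity) hn0.le,
          ← Real.rpow_natCast, ← Real.rpow_mul hn0.le, ← Real.rpow_mul hn0.le,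
          ← Real.rpow_add hn0, div_eq_mul_inv, ← Real.rpow_neg hn0.le]
        rw [show (2 : ℝ) ^ p * (n : ℝ) ^ (-(a * ((2 : ℕ) : ℝ) * p + p)) * (3 * n) =
          2 ^ p * 3 * ((n : ℝ) ^ (-(a * ((2 : ℕ) : ℝ) * p + p)) * (n : ℝ) ^ (1 : ℝ)) by
            rw [Real.rpow_one]; ring, ← Real.rpow_add hn0]
        congr 2
        push_cast
        ring

/-- If `a (1 - q) < 2 q`, the coefficient of the vertical moment vanishes along boxes of sides
`⌈n ^ a⌉` and `n`. -/
lemma tendsto_coeff_snd {a q : ℝ} (ha : 0 < a) (hq : 0 < q)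
    (h : a * (1 - q) - 2 * q < 0) :
    Tendsto (fun n : ℕ => ((2 / (n ^ 2 * (⌈(n : ℝ) ^ a⌉₊ : ℕ)) : ℝ≥0) : ℝ≥0∞) ^ q *
      ((2 * ⌈(n : ℝ) ^ a⌉₊ + 1 : ℕ) : ℝ≥0∞)) atTop (𝓝 0) := by
  have hlim : Tendsto (fun n : ℕ => ENNReal.ofReal (2 ^ q * 5 * (n : ℝ) ^ (a * (1 - q) - 2 * q)))
      atTop (𝓝 0) := by
    have := (tendsto_rpow_neg_atTop (y := -(a * (1 - q) - 2 * q)) (by linarith)).comp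
      (tendsto_natCast_atTop_atTop (R := ℝ))
    have h2 := ENNReal.tendsto_ofReal (this.const_mul (2 ^ q * 5 : ℝ))
    simpa [Function.comp_def] using h2
  refine tendsto_of_tendsto_of_tendsto_of_le_of_le' tendsto_const_nhds hlim
    (Eventually.of_forall fun _ => zero_le) ?_
  filter_upwards [eventually_ge_atTop 1] with n hn
  have hn1 : (1 : ℝ) ≤ n := by exact_mod_cast hn
  have hn0 : (0 : ℝ) < n := by linarith
  have hm : (n : ℝ) ^ a ≤ (⌈(n : ℝ) ^ a⌉₊ : ℕ) := Nat.le_ceil _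
  have ha1 : 1 ≤ (n : ℝ) ^ a := Real.one_le_rpow hn1 ha.le
  have hm2 : ((⌈(n : ℝ) ^ a⌉₊ : ℕ) : ℝ) < (n : ℝ) ^ a + 1 := Nat.ceil_lt_add_one (by positivity)
  rw [← ENNReal.coe_rpow_of_nonneg _ hq.le, ← ENNReal.coe_natCast, ← ENNReal.coe_mul,
    ← ENNReal.ofReal_coe_nnreal]
  refine ENNReal.ofReal_le_ofReal ?_
  push_cast
  calc (2 / ((n : ℝ) ^ 2 * (⌈(n : ℝ) ^ a⌉₊ : ℝ))) ^ q * (2 * (⌈(n : ℝ) ^ a⌉₊ : ℝ) + 1)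
      ≤ (2 / ((n : ℝ) ^ 2 * (n : ℝ) ^ a)) ^ q * (5 * (n : ℝ) ^ a) := by
        gcongr
        linarith
    _ = 2 ^ q * 5 * (n : ℝ) ^ (a * (1 - q) - 2 * q) := by
        rw [Real.div_rpow (by norm_num) (by positivity), ← Real.rpow_natCast (n : ℝ) 2,
          ← Real.rpow_add hn0, ← Real.rpow_mul hn0.le, div_eq_mul_inv, ← Real.rpow_neg hn0.le]
        rw [show ∀ x y : ℝ, (2 : ℝ) ^ q * x * (5 * y) = 2 ^ q * 5 * (x * y) by intros; ring,
          ← Real.rpow_add hn0]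
        congr 2
        push_cast
        ring

/-- The condition `ε₁ ε₂ < 1` leaves room for moment exponents `p < min α₁ 1`, `q < min α₂ 1` and an
aspect ratio `a` of the boxes. -/
lemma exists_exponents {α₁ α₂ : ℝ} (hα₁ : 0 < α₁) (hα₂ : 0 < α₂)
    (hε : max ((1 / α₁ - 1) / 2) 0 * max ((1 / α₂ - 1) / 2) 0 < 1) :
    ∃ p q a : ℝ, 0 < p ∧ p < α₁ ∧ p ≤ 1 ∧ 0 < q ∧ q < α₂ ∧ q ≤ 1 ∧ 0 < a ∧
      1 - p - 2 * a * p < 0 ∧ a * (1 - q) - 2 * q < 0 := by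
  obtain ⟨e₁, e₂, h₁, h₂, he⟩ : ∃ e₁ e₂ : ℝ, max ((1 / α₁ - 1) / 2) 0 < e₁ ∧
      max ((1 / α₂ - 1) / 2) 0 < e₂ ∧ e₁ * e₂ < 1 := by
    have hcont : Tendsto (fun t : ℝ => (max ((1 / α₁ - 1) / 2) 0 + t) *
        (max ((1 / α₂ - 1) / 2) 0 + t)) (𝓝[>] 0)
        (𝓝 ((max ((1 / α₁ - 1) / 2) 0 + 0) * (max ((1 / α₂ - 1) / 2) 0 + 0))) :=
      ((continuous_const.add continuous_id).mul
        (continuous_const.add continuous_id)).continuousWithinAt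
    obtain ⟨t, ht, ht0⟩ := ((hcont.eventually (gt_mem_nhds (by simpa using hε))).and
      self_mem_nhdsWithin).exists
    have ht0' : 0 < t := ht0
    exact ⟨_, _, lt_add_of_pos_right _ ht0', lt_add_of_pos_right _ ht0', ht⟩
  obtain ⟨h₁, h₁'⟩ := max_lt_iff.mp h₁
  obtain ⟨h₂, h₂'⟩ := max_lt_iff.mp h₂
  obtain ⟨a, ha₁, ha₂⟩ := exists_between (show e₁ < 1 / e₂ by rwa [lt_div_iff₀ h₂'])
  have hexp : ∀ {α e : ℝ}, 0 < α → 0 < e → (1 / α - 1) / 2 < e → 1 / (1 + 2 * e) < α := by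
    intro α e hα he h
    rw [div_lt_iff₀ (by positivity)]
    have : 1 / α < 1 + 2 * e := by linarith
    rwa [div_lt_iff₀ hα, mul_comm] at this
  -- the exponents with `(1 / p - 1) / 2 = e₁` and `(1 / q - 1) / 2 = e₂`
  refine ⟨1 / (1 + 2 * e₁), 1 / (1 + 2 * e₂), a, by positivity, hexp hα₁ h₁' h₁, ?_, by positivity,
    hexp hα₂ h₂' h₂, ?_, h₁'.trans ha₁, ?_, ?_⟩
  · rw [div_le_one (by positivity)]
    linarith
  · rw [div_le_one (by positivity)]
    linarith
  · rw [show 1 - 1 / (1 + 2 * e₁) - 2 * a * (1 / (1 + 2 * e₁)) = 2 * (e₁ - a) / (1 + 2 * e₁) by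
      field_simp; ring]
    exact div_neg_of_neg_of_pos (by linarith) (by positivity)
  · rw [lt_div_iff₀ h₂'] at ha₂
    rw [show a * (1 - 1 / (1 + 2 * e₂)) - 2 * (1 / (1 + 2 * e₂)) = 2 * (a * e₂ - 1) / (1 + 2 * e₂) by
      field_simp; ring]
    exact div_neg_of_neg_of_pos (by linarith) (by positivity)

end LineModel

theorem proposition3p1
    {Ω : Type*} [MeasurableSpace Ω] (μ : Measure Ω) [IsProbabilityMeasure μ]
    (H V : ℤ → Ω → ℝ≥0)
    (hHmeas : ∀ k, Measurable (H k)) (hVmeas : ∀ k, Measurable (V k))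
    -- the `H k` are i.i.d., the `V k` are i.i.d., and the two families are independent
    (hHindep : iIndepFun H μ) (hHident : ∀ k, IdentDistrib (H k) (H 0) μ μ)
    (hVindep : iIndepFun V μ) (hVident : ∀ k, IdentDistrib (V k) (V 0) μ μ)
    (hHV : IndepFun (fun ω k => H k ω) (fun ω k => V k ω) μ)
    -- (H1): the conductances are bounded below
    (c : ℝ≥0) (hc : 0 < c)
    (hHc : ∀ k, ∀ᵐ ω ∂μ, c ≤ H k ω) (hVc : ∀ k, ∀ᵐ ω ∂μ, c ≤ V k ω)
    -- (H2): the tails are `c_H L ^ (-α₁ (1 + o(1)))` and `c_V L ^ (-α₂ (1 + o(1)))` as `L → ∞`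
    (α₁ α₂ cH cV : ℝ) (hα₁ : 0 < α₁) (hα₂ : 0 < α₂) (hcH : 0 < cH) (hcV : 0 < cV)
    (hHtail : ∃ o : ℝ → ℝ, Tendsto o atTop (𝓝 0) ∧
      ∀ᶠ L : ℝ in atTop, μ.real {ω | L < (H 0 ω : ℝ)} = cH * L ^ (-α₁ * (1 + o L)))
    (hVtail : ∃ o : ℝ → ℝ, Tendsto o atTop (𝓝 0) ∧
      ∀ᶠ L : ℝ in atTop, μ.real {ω | L < (V 0 ω : ℝ)} = cV * L ^ (-α₂ * (1 + o L)))
    -- `ε₁ ε₂ < 1`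
    (hε : max ((1 / α₁ - 1) / 2) 0 * max ((1 / α₂ - 1) / 2) 0 < 1) :
    ∀ᵐ ω ∂μ, ∀ t : ℝ≥0,
      ∀ᵐ γ ∂(LineModel.walkLaw (LineModel.conductance (fun k => H k ω) (fun k => V k ω))),
        LineModel.numJumps γ t < ⊤ := by
  obtain ⟨p, q, a, hp, hpα, hp1, hq, hqα, hq1, ha, h1, h2⟩ :=
    LineModel.exists_exponents hα₁ hα₂ hε
  have hHmom := LineModel.lintegral_rpow_lt_top_of_tail (hHmeas 0) hp hpα hHtail
  have hVmom := LineModel.lintegral_rpow_lt_top_of_tail (hVmeas 0) hq hqα hVtail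
  set U : ℝ≥0∞ := ∫⁻ ω, LineModel.explosionLaplace
    (LineModel.conductance (fun k => H k ω) (fun k => V k ω)) (0, 0) ∂μ with hU
  have hU0 : U = 0 := by
    have hlim := (ENNReal.Tendsto.mul_const (LineModel.tendsto_coeff_fst hp h1)
      (Or.inr hHmom.ne)).add (ENNReal.Tendsto.mul_const
        (LineModel.tendsto_coeff_snd ha hq h2) (Or.inr hVmom.ne))
    simp only [zero_mul, add_zero] at hlim
    refine le_antisymm (ge_of_tendsto hlim ?_) zero_le
    filter_upwards [eventually_ge_atTop 1] with n hn
    have hm : 0 < ⌈(n : ℝ) ^ a⌉₊ := Nat.ceil_pos.mpr (Real.rpow_pos_of_pos (by exact_mod_cast hn) a)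
    simpa only [mul_assoc] using LineModel.lintegral_explosionLaplace_le hHmeas hVmeas hHindep
      hHident hVindep hVident hHV hp hp1 hq hq1 hm hn
  have hmeas : Measurable fun ω => (LineModel.explosionLaplace
      (LineModel.conductance (fun k => H k ω) (fun k => V k ω)) (0, 0) : ℝ≥0∞) :=
    ((LineModel.measurable_explosionLaplace (0, 0)).comp
      ((measurable_pi_lambda _ hHmeas).prodMk
        (measurable_pi_lambda _ hVmeas))).coe_nnreal_ennreal
  rw [hU, lintegral_eq_zero_iff hmeas] at hU0
  filter_upwards [hU0] with ω hω t
  have hω0 : LineModel.explosionLaplace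
      (LineModel.conductance (fun k => H k ω) (fun k => V k ω)) (0, 0) = 0 := by
    simpa using hω
  filter_upwards [LineModel.ae_numJumps_lt_top hω0] with γ hγ
  exact hγ t
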